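/- **Setting.** Let $d\ge 1$, $0<m<2$, and let $\|\cdot\|$ be the Euclidean norm on $\mathbb{R}^d$ and $\|\cdot\|_F$ the Frobenius norm. *Target.* Let $U:\mathbb{R}^d\to\mathbb{R}$ be twice continuously differentiable and attain a global minimum at some $x_*$ with $U(x_*)=0$, and suppose there are constants $d_k,D_k>0$ ($k=1,2,3$), $r>0$ and $R>0$ such that for all $x$ with $\|x\|\ge R$ $$d_1\|x\|^m\le U(x)\le D_1\|x\|^m,\qquad d_2\|x\|^{m-1}\le\|\nabla U(x)\|\le D_2\|x\|^{m-1},$$ $$\frac{\nabla U(x)}{\|\nabla U(x)\|}\cdot\frac{x}{\|x\|}\ge r,\qquad d_3\|x\|^{m-2}\le\|\nabla^2U(x)\|_F\le D_3\|x\|^{m-2}.$$ Let $\pi(dx)=Z^{-1}e^{-U(x)}\,dx$ with $Z=\int_{\mathbb{R}^d} e^{-U(x)}\,dx$. *Metropolis family.* Let $g_K$ be a Lebesgue probability density on $\mathbb{R}^d$ that vanishes off a compact set $K$, depends on $\xi$ only through $\|\xi\|$, and satisfies $\inf_{\xi\in K}g_K(\xi)>0$. Let $\lambda_*>0$, $\lambda^*\in\mathbb{R}$,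 and $$\mathcal{Y}=\{\gamma\in\mathbb{R}^{d\times d}:\gamma^T=\gamma,\ \lambda_*I\le\gamma\le\lambda^*I\}.$$ For $\gamma\in\mathcal{Y}$, $x\in\mathbb{R}^d$ and Borel $A\subseteq\mathbb{R}^d$ let, with $a(x,y)=\exp[U(x)-U(y)]\wedge1$, $$\mathcal{P}_\gamma(x,A)=\int_{\mathbb{R}^d}\mathbf{1}_A(x+\gamma^{1/2}\xi)\,a(x,x+\gamma^{1/2}\xi)\,g_K(\xi)\,d\xi+\delta_x(A)\Big(1-\int_{\mathbb{R}^d}a(x,x+\gamma^{1/2}\xi)\,g_K(\xi)\,d\xi\Big).$$ *Adaptive process.* An adaptation plan $\mathcal{Q}=(\mathcal{Q}_t)_{t\ge1}$ is a sequence of Borel probability kernels $\mathcal{Q}_t$ from $(\mathcal{Y}\times\mathbb{R}^d)^t$ to $\mathcal{Y}$; let $\mathcal{S}$ be the set of all adaptation plans. Given $\mathcal{Q}\in\mathcal{S}$, $\gamma_0\in\mathcal{Y}$ and $x_0\in\mathbb{R}^d$, the process $(\Gamma_t,X_t)_{t\ge0}$ starts at $(\Gamma_0,X_0)=(\gamma_0,x_0)$,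 and for $t\ge1$, given $(\Gamma_s,X_s)_{s\le t-1}$, first $\Gamma_t\sim\mathcal{Q}_t((\Gamma_s,X_s)_{s\le t-1},\cdot)$ and then $X_t\sim\mathcal{P}_{\Gamma_t}(X_{t-1},\cdot)$. Let $\mathcal{A}^{(t)}_{\mathcal{Q}}(\gamma_0,x_0,\cdot)$ be the law of $X_t$. *Distance.* For Borel probability measures $\mu,\nu$ on $\mathbb{R}^d$ let $\mathcal{W}_{\|\cdot\|\wedge1}(\mu,\nu)=\inf_\xi\int(\|x-y\|\wedge1)\,\xi(dx,dy)$, the infimum over all couplings $\xi$ of $\mu$ and $\nu$. **Claim.** With $d,m,U,g_K,\lambda_*,\lambda^*$ fixed, there is a constant $c_*>0$ such that for every $x_0\in\mathbb{R}^d$ there is a constant $M_*>0$ (depending on $x_0$) such that for all $\gamma_0\in\mathcal{Y}$ and all integers $t\ge0$ $$\inf_{\mathcal{Q}\in\mathcal{S}}\mathcal{W}_{\|\cdot\|\wedge1}\big(\mathcal{A}^{(t)}_{\mathcal{Q}}(\gamma_0,x_0,\cdot),\pi\big)\ \ge\ M_*\exp\big(-c_*\,t^{m/(2-m)}\big).$$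 -/

import Mathlib

open MeasureTheory ProbabilityTheory
open scoped MatrixOrder ENNReal

/-! ## Adaptive processes

`Y` is the space of tuning parameters, `X` the state space, and `P : Kernel (Y × X) X` a family of
Markov kernels `P (γ, x) = P_γ(x, ·)`. -/

section AdaptiveProcess

/-- An adaptation plan: `kernel t` is the conditional law of the tuning parameter `Γ_{t+1}` given
the history `(Γ_s, X_s)_{0 ≤ s ≤ t}`. -/
structure AdaptationPlan (Y X : Type) [MeasurableSpace Y] [MeasurableSpace X] where
  kernel : (t : ℕ) → Kernel (Finset.Iic t → Y × X) Y
  isMarkovKernel : ∀ t, IsMarkovKernel (kernel t)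

attribute [instance] AdaptationPlan.isMarkovKernel

/-- The conditional law of `(Γ_{t+1}, X_{t+1})` given the history up to time `t`: first
`Γ_{t+1} ∼ Q_{t+1}(history, ·)`, then `X_{t+1} ∼ P_{Γ_{t+1}}(X_t, ·)`. -/
noncomputable def adaptiveStep {Y X : Type} [MeasurableSpace Y] [MeasurableSpace X]
    (P : Kernel (Y × X) X) (Q : AdaptationPlan Y X) (t : ℕ) :
    Kernel (Finset.Iic t → Y × X) (Y × X) :=
  Q.kernel t ⊗ₖ P.comap
    (fun p : (Finset.Iic t → Y × X) × Y => (p.2, (p.1 ⟨t, Finset.mem_Iic.2 le_rfl⟩).2))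
    (by fun_prop)

instance {Y X : Type} [MeasurableSpace Y] [MeasurableSpace X]
    (P : Kernel (Y × X) X) [IsMarkovKernel P] (Q : AdaptationPlan Y X) (t : ℕ) :
    IsMarkovKernel (adaptiveStep P Q t) := by
  unfold adaptiveStep; infer_instance

/-- The law of the whole process `(Γ_t, X_t)_{t ≥ 0}` started at the fixed point `(γ₀, x₀)`
(Ionescu-Tulcea). -/
noncomputable def adaptiveLaw {Y X : Type} [MeasurableSpace Y] [MeasurableSpace X]
    (P : Kernel (Y × X) X) [IsMarkovKernel P] (Q : AdaptationPlan Y X) (γ₀ : Y) (x₀ : X) :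
    Measure (ℕ → Y × X) :=
  Kernel.traj (X := fun _ : ℕ => Y × X) (adaptiveStep P Q) 0 (fun _ => (γ₀, x₀))

/-- The law of `X_t`. -/
noncomputable def adaptiveMarginal {Y X : Type} [MeasurableSpace Y] [MeasurableSpace X]
    (P : Kernel (Y × X) X) [IsMarkovKernel P] (Q : AdaptationPlan Y X) (t : ℕ) (γ₀ : Y) (x₀ : X) :
    Measure X :=
  (adaptiveLaw P Q γ₀ x₀).map (fun ω => (ω t).2)

end AdaptiveProcess

/-! ## The bounded Wasserstein distance -/

/-- Couplings of two measures. -/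
def couplings {X : Type} [MeasurableSpace X] (μ ν : Measure X) : Set (Measure (X × X)) :=
  {ξ | IsProbabilityMeasure ξ ∧ ξ.map Prod.fst = μ ∧ ξ.map Prod.snd = ν}

/-- The Wasserstein distance with respect to the cost `d(x, y) ∧ 1`. -/
noncomputable def wassersteinMinOne {X : Type} [MeasurableSpace X] [PseudoMetricSpace X]
    (μ ν : Measure X) : ℝ≥0∞ :=
  ⨅ ξ ∈ couplings μ ν, ∫⁻ p, ENNReal.ofReal (min (dist p.1 p.2) 1) ∂ξ

/-! ## The target -/

/-- The probability measure `Z⁻¹ exp (-U x) dx`. -/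
noncomputable def gibbsMeasure {d : ℕ} (U : EuclideanSpace ℝ (Fin d) → ℝ) :
    Measure (EuclideanSpace ℝ (Fin d)) :=
  volume.withDensity fun x => ENNReal.ofReal (Real.exp (-U x) / ∫ y, Real.exp (-U y))

/-- The Hessian matrix of second partial derivatives. -/
noncomputable def hessianMatrix {d : ℕ} (U : EuclideanSpace ℝ (Fin d) → ℝ)
    (x : EuclideanSpace ℝ (Fin d)) : Matrix (Fin d) (Fin d) ℝ :=
  Matrix.of fun i j => fderiv ℝ (fun y => fderiv ℝ U y (EuclideanSpace.single j 1)) x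
    (EuclideanSpace.single i 1)

/-- The Frobenius norm. -/
noncomputable def frobeniusNorm {d : ℕ} (A : Matrix (Fin d) (Fin d) ℝ) : ℝ :=
  Real.sqrt (∑ i, ∑ j, A i j ^ 2)

/-- The regularity assumptions on the potential `U`, with growth exponent `m`. -/
structure PotentialRegularity {d : ℕ} (U : EuclideanSpace ℝ (Fin d) → ℝ) (m : ℝ) : Prop where
  contDiff : ContDiff ℝ 2 U
  exists_min : ∃ x₀, U x₀ = 0 ∧ ∀ x, U x₀ ≤ U x
  growth : ∃ d₁ d₂ d₃ D₁ D₂ D₃ r R : ℝ,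
    0 < d₁ ∧ 0 < d₂ ∧ 0 < d₃ ∧ 0 < D₁ ∧ 0 < D₂ ∧ 0 < D₃ ∧ 0 < r ∧ 0 < R ∧
    ∀ x, R ≤ ‖x‖ →
      (d₁ * ‖x‖ ^ m ≤ U x ∧ U x ≤ D₁ * ‖x‖ ^ m) ∧
      (d₂ * ‖x‖ ^ (m - 1) ≤ ‖gradient U x‖ ∧ ‖gradient U x‖ ≤ D₂ * ‖x‖ ^ (m - 1)) ∧
      r ≤ inner ℝ (‖gradient U x‖⁻¹ • gradient U x) (‖x‖⁻¹ • x) ∧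
      (d₃ * ‖x‖ ^ (m - 2) ≤ frobeniusNorm (hessianMatrix U x) ∧
        frobeniusNorm (hessianMatrix U x) ≤ D₃ * ‖x‖ ^ (m - 2))

/-! ## The set of covariance matrices -/

/-- Symmetric matrices `γ` with `lo • I ≤ γ ≤ hi • I` in the Loewner order. -/
def covarianceSet (d : ℕ) (lo hi : ℝ) : Set (Matrix (Fin d) (Fin d) ℝ) :=
  {γ | lo • (1 : Matrix (Fin d) (Fin d) ℝ) ≤ γ ∧ γ ≤ hi • (1 : Matrix (Fin d) (Fin d) ℝ) ∧
    γ.transpose = γ}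

noncomputable instance (d : ℕ) (lo hi : ℝ) : MeasurableSpace (covarianceSet d lo hi) := borel _

instance (d : ℕ) (lo hi : ℝ) : BorelSpace (covarianceSet d lo hi) := ⟨rfl⟩

theorem covarianceSet_nonneg {d : ℕ} {lo hi : ℝ} (hlo : 0 < lo) (γ : covarianceSet d lo hi) :
    (0 : Matrix (Fin d) (Fin d) ℝ) ≤ γ.1 := by
  refine le_trans ?_ γ.2.1
  rw [Matrix.nonneg_iff_posSemidef]
  exact Matrix.PosSemidef.one.smul hlo.le

/-- The square root `γ ↦ γ^{1/2}` is continuous on the set of covariance matrices. -/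
theorem continuous_sqrt_covarianceSet {d : ℕ} {lo hi : ℝ} (hlo : 0 < lo) :
    Continuous fun γ : covarianceSet d lo hi => CFC.sqrt γ.1 := by
  have h : ContinuousOn (CFC.sqrt (A := Matrix (Fin d) (Fin d) ℝ)) {a | 0 ≤ a} := by
    open scoped Matrix.Norms.L2Operator in
    exact CFC.continuousOn_sqrt
  exact h.comp_continuous continuous_subtype_val fun γ => covarianceSet_nonneg hlo γ

/-! ## Random-walk Metropolis -/

/-- A Lebesgue probability density `g` on `ℝᵈ`, radially symmetric, vanishing off a compact set `K`
and bounded below by a positive constant on `K`. -/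
structure ProposalDensity (d : ℕ) where
  g : EuclideanSpace ℝ (Fin d) → ℝ
  K : Set (EuclideanSpace ℝ (Fin d))
  measurable_g : Measurable g
  nonneg : ∀ ξ, 0 ≤ g ξ
  lintegral_eq_one : ∫⁻ ξ, ENNReal.ofReal (g ξ) = 1
  isCompact_K : IsCompact K
  eq_zero : ∀ ξ, ξ ∉ K → g ξ = 0
  radial : ∀ ξ η, ‖ξ‖ = ‖η‖ → g ξ = g η
  lower_bound : ∃ ε > 0, ∀ ξ ∈ K, ε ≤ g ξ

/-- The acceptance function `exp (U x - U y) ∧ 1`. -/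
noncomputable def acceptance {d : ℕ} (U : EuclideanSpace ℝ (Fin d) → ℝ)
    (x y : EuclideanSpace ℝ (Fin d)) : ℝ :=
  min (Real.exp (U x - U y)) 1

theorem acceptance_nonneg {d : ℕ} (U : EuclideanSpace ℝ (Fin d) → ℝ)
    (x y : EuclideanSpace ℝ (Fin d)) : 0 ≤ acceptance U x y :=
  le_min (Real.exp_pos _).le zero_le_one

/-- The proposed point `x + γ^{1/2} ξ`. -/
noncomputable def proposalPoint {d : ℕ} (γ : Matrix (Fin d) (Fin d) ℝ)
    (x ξ : EuclideanSpace ℝ (Fin d)) : EuclideanSpace ℝ (Fin d) :=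
  x + Matrix.toEuclideanCLM (𝕜 := ℝ) (CFC.sqrt γ) ξ

/-- The rejection probability. -/
noncomputable def rejection {d : ℕ} (U : EuclideanSpace ℝ (Fin d) → ℝ) (q : ProposalDensity d)
    (γ : Matrix (Fin d) (Fin d) ℝ) (x : EuclideanSpace ℝ (Fin d)) : ℝ :=
  1 - ∫ ξ, acceptance U x (proposalPoint γ x ξ) * q.g ξ

/-- The random-walk Metropolis transition probability
`A ↦ ∫ 1_A(x + γ^{1/2} ξ) a(x, x + γ^{1/2} ξ) g(ξ) dξ + R_γ(x) δ_x(A)`. -/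
noncomputable def rwmMeasure {d : ℕ} (U : EuclideanSpace ℝ (Fin d) → ℝ) (q : ProposalDensity d)
    (γ : Matrix (Fin d) (Fin d) ℝ) (x : EuclideanSpace ℝ (Fin d)) :
    Measure (EuclideanSpace ℝ (Fin d)) :=
  (volume.withDensity fun ξ =>
      ENNReal.ofReal (acceptance U x (proposalPoint γ x ξ) * q.g ξ)).map (proposalPoint γ x) +
    ENNReal.ofReal (rejection U q γ x) • Measure.dirac x

theorem measurable_proposalPoint_right {d : ℕ} (γ : Matrix (Fin d) (Fin d) ℝ)
    (x : EuclideanSpace ℝ (Fin d)) : Measurable (proposalPoint γ x) := by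
  unfold proposalPoint
  fun_prop

theorem measurable_proposalPoint {d : ℕ} {lo hi : ℝ} (hlo : 0 < lo) :
    Measurable fun p : (covarianceSet d lo hi × EuclideanSpace ℝ (Fin d)) ×
      EuclideanSpace ℝ (Fin d) => proposalPoint p.1.1.1 p.1.2 p.2 := by
  have h2 : Continuous fun p : (covarianceSet d lo hi) × EuclideanSpace ℝ (Fin d) =>
      WithLp.toLp 2 ((CFC.sqrt p.1.1).mulVec p.2.ofLp) :=
    (PiLp.continuous_toLp 2 _).comp (Continuous.matrix_mulVec
      ((continuous_sqrt_covarianceSet hlo).comp continuous_fst)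
      ((PiLp.continuous_ofLp 2 _).comp continuous_snd))
  have h4 : Measurable fun p : (covarianceSet d lo hi × EuclideanSpace ℝ (Fin d)) ×
      EuclideanSpace ℝ (Fin d) => (p.1.1, p.2) := by fun_prop
  exact (measurable_snd.comp measurable_fst).add (h2.measurable.comp h4)

theorem rwmMeasure_apply {d : ℕ} (U : EuclideanSpace ℝ (Fin d) → ℝ) (hU : Measurable U)
    (q : ProposalDensity d) (γ : Matrix (Fin d) (Fin d) ℝ) (x : EuclideanSpace ℝ (Fin d))
    {s : Set (EuclideanSpace ℝ (Fin d))} (hs : MeasurableSet s) :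
    rwmMeasure U q γ x s =
      (∫⁻ ξ, s.indicator (fun y => ENNReal.ofReal (acceptance U x y)) (proposalPoint γ x ξ) *
        ENNReal.ofReal (q.g ξ)) +
      ENNReal.ofReal (rejection U q γ x) * s.indicator 1 x := by
  have hp := measurable_proposalPoint_right γ x
  have ha : Measurable (acceptance U x) := by unfold acceptance; fun_prop
  unfold rwmMeasure
  rw [Measure.add_apply, Measure.map_apply hp hs, withDensity_apply _ (hp hs),
    Measure.smul_apply, Measure.dirac_apply' _ hs, smul_eq_mul, ← lintegral_indicator (hp hs)]
  congr 1
  refine lintegral_congr fun ξ => ?_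
  by_cases h : proposalPoint γ x ξ ∈ s
  · rw [Set.indicator_of_mem h, Set.indicator_of_mem (by exact h),
      ENNReal.ofReal_mul (acceptance_nonneg U x _)]
  · rw [Set.indicator_of_notMem h, Set.indicator_of_notMem (by exact h), zero_mul]

theorem isProbabilityMeasure_rwmMeasure {d : ℕ} (U : EuclideanSpace ℝ (Fin d) → ℝ)
    (hU : Measurable U) (q : ProposalDensity d) (γ : Matrix (Fin d) (Fin d) ℝ)
    (x : EuclideanSpace ℝ (Fin d)) : IsProbabilityMeasure (rwmMeasure U q γ x) := by
  have hp := measurable_proposalPoint_right γ x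
  have ha : Measurable (acceptance U x) := by unfold acceptance; fun_prop
  have hg := q.measurable_g
  have h0 : ∀ ξ, 0 ≤ acceptance U x (proposalPoint γ x ξ) * q.g ξ := fun ξ =>
    mul_nonneg (acceptance_nonneg U x _) (q.nonneg ξ)
  have hle : ∫⁻ ξ, ENNReal.ofReal (acceptance U x (proposalPoint γ x ξ) * q.g ξ) ≤ 1 := by
    rw [← q.lintegral_eq_one]
    refine lintegral_mono fun ξ => ENNReal.ofReal_le_ofReal ?_
    exact mul_le_of_le_one_left (q.nonneg ξ) (min_le_right _ _)
  have hint : ENNReal.ofReal (∫ ξ, acceptance U x (proposalPoint γ x ξ) * q.g ξ) =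
      ∫⁻ ξ, ENNReal.ofReal (acceptance U x (proposalPoint γ x ξ) * q.g ξ) := by
    rw [integral_eq_lintegral_of_nonneg_ae (Filter.Eventually.of_forall h0)
      (((ha.comp hp).mul hg).aestronglyMeasurable), ENNReal.ofReal_toReal]
    exact ne_top_of_le_ne_top ENNReal.one_ne_top hle
  refine ⟨?_⟩
  unfold rwmMeasure
  rw [Measure.add_apply, Measure.map_apply hp MeasurableSet.univ, Set.preimage_univ,
    withDensity_apply _ MeasurableSet.univ, Measure.restrict_univ, Measure.smul_apply,
    measure_univ, smul_eq_mul, mul_one, rejection,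
    ENNReal.ofReal_sub _ (integral_nonneg h0), hint, ENNReal.ofReal_one]
  exact add_tsub_cancel_of_le hle

theorem measurable_rwmMeasure {d : ℕ} (U : EuclideanSpace ℝ (Fin d) → ℝ) (hU : Measurable U)
    (q : ProposalDensity d) {lo hi : ℝ} (hlo : 0 < lo) :
    Measurable fun p : covarianceSet d lo hi × EuclideanSpace ℝ (Fin d) =>
      rwmMeasure U q p.1.1 p.2 := by
  have hp := measurable_proposalPoint (d := d) (hi := hi) hlo
  have hg := q.measurable_g
  have ha : Measurable fun p : EuclideanSpace ℝ (Fin d) × EuclideanSpace ℝ (Fin d) =>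
      acceptance U p.1 p.2 := by unfold acceptance; fun_prop
  have hap : Measurable fun p : (covarianceSet d lo hi × EuclideanSpace ℝ (Fin d)) ×
      EuclideanSpace ℝ (Fin d) => acceptance U p.1.2 (proposalPoint p.1.1.1 p.1.2 p.2) :=
    ha.comp ((measurable_snd.comp measurable_fst).prodMk hp)
  refine Measure.measurable_of_measurable_coe _ fun s hs => ?_
  simp_rw [rwmMeasure_apply U hU q _ _ hs]
  refine Measurable.add ?_ (Measurable.mul ?_ ?_)
  · refine Measurable.lintegral_prod_right' (f := fun p : (covarianceSet d lo hi ×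
      EuclideanSpace ℝ (Fin d)) × EuclideanSpace ℝ (Fin d) =>
      s.indicator (fun y => ENNReal.ofReal (acceptance U p.1.2 y))
        (proposalPoint p.1.1.1 p.1.2 p.2) * ENNReal.ofReal (q.g p.2)) ?_
    refine Measurable.mul ?_ (hg.comp measurable_snd).ennreal_ofReal
    exact (hap.ennreal_ofReal).indicator (hp hs)
  · refine Measurable.ennreal_ofReal (measurable_const.sub ?_)
    exact (StronglyMeasurable.integral_prod_right'
      (hap.mul (hg.comp measurable_snd)).stronglyMeasurable).measurable
  · exact (measurable_one.indicator hs).comp measurable_snd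

/-- The random-walk Metropolis family as a Markov kernel. -/
noncomputable def rwmKernel {d : ℕ} (U : EuclideanSpace ℝ (Fin d) → ℝ) (hU : Measurable U)
    (q : ProposalDensity d) {lo : ℝ} (hlo : 0 < lo) (hi : ℝ) :
    Kernel (covarianceSet d lo hi × EuclideanSpace ℝ (Fin d)) (EuclideanSpace ℝ (Fin d)) where
  toFun p := rwmMeasure U q p.1.1 p.2
  measurable' := measurable_rwmMeasure U hU q hlo

instance {d : ℕ} (U : EuclideanSpace ℝ (Fin d) → ℝ) (hU : Measurable U)
    (q : ProposalDensity d) {lo : ℝ} (hlo : 0 < lo) (hi : ℝ) :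
    IsMarkovKernel (rwmKernel U hU q hlo hi) :=
  ⟨fun p => isProbabilityMeasure_rwmMeasure U hU q p.1.1 p.2⟩

/-! The obstruction is in the tails: the target puts mass of order at least `exp (-C σ ^ m)` beyond
distance `σ`, and an adaptive Metropolis process needs a long time to put comparable mass there. A
coupling must carry the missing mass over distance at least one, at cost one per unit of mass. So if
after `t` steps the process has, beyond `B σ`, less mass than a small fraction of what the target
has beyond `B σ + 1`, the distance is at least `exp (-c σ ^ m)` (`exists_exp_le_wassersteinMinOne`).

How long this lasts depends on `m`. For `m ≥ 1`, increments bounded by `L` suffice: a process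
started within `σ` is within `(1 + L) σ` up to time `σ`. For `m < 1` the diffusive time `σ ^ (2 -
m)` is needed. Rejection only lowers the mean of an increasing function of `U`, so `exp (s U)` can
be followed along the unadjusted random walk, whose symmetry cancels first-order terms. Far out, the
relative growth per step is then of order `‖∇U‖ ^ 2 + ‖∇²U‖`, at most of order `σ ^ (2 m - 2)`. Over
`σ ^ (2 - m)` steps this accumulates to `exp (C σ ^ m)`, and Markov's inequality with `s` large
bounds the tail.

All one-step estimates are uniform in the tuning parameter, so they survive averaging over any
adaptation plan. Finally, taking `σ` of order `t ^ (1 / p)`, with `p` the time exponent, gives `σ ^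
m` of order `t ^ (m / p)`, and `p ≥ 2 - m`. -/

/-! ### One-step inequalities along an adaptive process. -/

section AdaptiveProcess

variable {Y X : Type} [MeasurableSpace Y] [MeasurableSpace X]

theorem lintegral_adaptiveMarginal (P : Kernel (Y × X) X) [IsMarkovKernel P]
    (Q : AdaptationPlan Y X) (t : ℕ) (γ₀ : Y) (x₀ : X) {f : X → ℝ≥0∞} (hf : Measurable f) :
    ∫⁻ x, f x ∂adaptiveMarginal P Q t γ₀ x₀ = ∫⁻ ω, f (ω t).2 ∂adaptiveLaw P Q γ₀ x₀ := by
  unfold adaptiveMarginal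
  rw [lintegral_map hf (by fun_prop)]

instance isProbabilityMeasure_adaptiveLaw (P : Kernel (Y × X) X) [IsMarkovKernel P]
    (Q : AdaptationPlan Y X) (γ₀ : Y) (x₀ : X) :
    IsProbabilityMeasure (adaptiveLaw P Q γ₀ x₀) := by
  unfold adaptiveLaw; infer_instance

instance isProbabilityMeasure_adaptiveMarginal (P : Kernel (Y × X) X) [IsMarkovKernel P]
    (Q : AdaptationPlan Y X) (t : ℕ) (γ₀ : Y) (x₀ : X) :
    IsProbabilityMeasure (adaptiveMarginal P Q t γ₀ x₀) :=
  Measure.isProbabilityMeasure_map (Measurable.aemeasurable (by fun_prop))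

theorem lintegral_adaptiveMarginal_zero (P : Kernel (Y × X) X) [IsMarkovKernel P]
    (Q : AdaptationPlan Y X) (γ₀ : Y) (x₀ : X) {f : X → ℝ≥0∞} (hf : Measurable f) :
    ∫⁻ x, f x ∂adaptiveMarginal P Q 0 γ₀ x₀ = f x₀ := by
  rw [lintegral_adaptiveMarginal P Q 0 γ₀ x₀ hf, adaptiveLaw, Kernel.lintegral_traj _ (by fun_prop)]
  simp [Function.updateFinset]

theorem lintegral_adaptiveStep_snd (P : Kernel (Y × X) X) [IsMarkovKernel P]
    (Q : AdaptationPlan Y X) (t : ℕ) (h : Finset.Iic t → Y × X) {f : X → ℝ≥0∞}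
    (hf : Measurable f) :
    ∫⁻ z, f z.2 ∂adaptiveStep P Q t h =
      ∫⁻ γ, ∫⁻ x, f x ∂P (γ, (h ⟨t, Finset.mem_Iic.2 le_rfl⟩).2) ∂Q.kernel t h := by
  unfold adaptiveStep
  rw [Kernel.lintegral_compProd _ _ _ (by fun_prop)]
  simp only [Kernel.comap_apply]

/-- A one-step drift inequality holding for every tuning parameter passes to the adaptive
process. -/
theorem lintegral_adaptiveMarginal_succ_le (P : Kernel (Y × X) X) [IsMarkovKernel P]
    (Q : AdaptationPlan Y X) (t : ℕ) (γ₀ : Y) (x₀ : X) {f h : X → ℝ≥0∞} (hf : Measurable f)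
    (hh : Measurable h) (hP : ∀ γ x, ∫⁻ y, f y ∂P (γ, x) ≤ h x) :
    ∫⁻ x, f x ∂adaptiveMarginal P Q (t + 1) γ₀ x₀ ≤ ∫⁻ x, h x ∂adaptiveMarginal P Q t γ₀ x₀ := by
  rw [lintegral_adaptiveMarginal P Q (t + 1) γ₀ x₀ hf, lintegral_adaptiveMarginal P Q t γ₀ x₀ hh]
  unfold adaptiveLaw
  -- Markov decomposition at time `t`: sample the history up to `t`, then continue the trajectory
  -- from it.
  have hL : ∫⁻ ω, f (ω (t + 1)).2 ∂Kernel.traj (X := fun _ : ℕ => Y × X) (adaptiveStep P Q) 0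
      (fun _ => (γ₀, x₀)) = ∫⁻ w, ∫⁻ ω, f (ω (t + 1)).2
        ∂Kernel.traj (X := fun _ : ℕ => Y × X) (adaptiveStep P Q) t w
        ∂Kernel.partialTraj (X := fun _ : ℕ => Y × X) (adaptiveStep P Q) 0 t
          (fun _ => (γ₀, x₀)) := by
    rw [← Kernel.lintegral_comp _ _ _ (by fun_prop),
      Kernel.traj_comp_partialTraj (X := fun _ : ℕ => Y × X) (Nat.zero_le t)]
  have hR : ∫⁻ ω, h (ω t).2 ∂Kernel.traj (X := fun _ : ℕ => Y × X) (adaptiveStep P Q) 0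
      (fun _ => (γ₀, x₀)) = ∫⁻ w, h (w ⟨t, Finset.mem_Iic.2 le_rfl⟩).2
        ∂Kernel.partialTraj (X := fun _ : ℕ => Y × X) (adaptiveStep P Q) 0 t
          (fun _ => (γ₀, x₀)) := by
    rw [← Kernel.traj_map_frestrictLe_apply, lintegral_map (by fun_prop) (by fun_prop)]
    rfl
  rw [hL, hR]
  refine lintegral_mono fun w => ?_
  have h1 : ∫⁻ ω, f (ω (t + 1)).2 ∂Kernel.traj (X := fun _ : ℕ => Y × X) (adaptiveStep P Q) t w =
      ∫⁻ z, f z.2 ∂adaptiveStep P Q t w := by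
    have := Kernel.map_traj_succ_self (X := fun _ : ℕ => Y × X) (κ := adaptiveStep P Q) (a := t)
    conv_rhs => rw [← this]
    rw [Kernel.lintegral_map _ (by fun_prop) _ (by fun_prop)]
  rw [h1, lintegral_adaptiveStep_snd P Q t w hf]
  calc _ ≤ ∫⁻ _, h (w ⟨t, Finset.mem_Iic.2 le_rfl⟩).2 ∂Q.kernel t w :=
        lintegral_mono fun γ => hP γ _
    _ = _ := by simp

/-- An affine drift inequality iterates along the adaptive process. -/
theorem lintegral_adaptiveMarginal_le_of_drift (P : Kernel (Y × X) X) [IsMarkovKernel P]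
    (Q : AdaptationPlan Y X) (γ₀ : Y) (x₀ : X) {f : X → ℝ≥0∞} (hf : Measurable f)
    {a b : ℝ≥0∞} (ha : 1 ≤ a) (hP : ∀ γ x, ∫⁻ y, f y ∂P (γ, x) ≤ a * f x + b) (t : ℕ) :
    ∫⁻ x, f x ∂adaptiveMarginal P Q t γ₀ x₀ ≤ a ^ t * (f x₀ + t * b) := by
  induction t with
  | zero => simp [lintegral_adaptiveMarginal_zero P Q γ₀ x₀ hf]
  | succ t ih =>
    refine (lintegral_adaptiveMarginal_succ_le P Q t γ₀ x₀ hf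
      ((hf.const_mul a).add_const b) hP).trans ?_
    rw [lintegral_add_right _ measurable_const, lintegral_const_mul _ hf, lintegral_const,
      measure_univ, mul_one]
    -- Each additive `b` is charged the full factor `a ^ (t + 1) ≥ 1`, which keeps the bound in
    -- product form.
    calc _ ≤ a * (a ^ t * (f x₀ + t * b)) + a ^ (t + 1) * b := by
          gcongr
          exact le_mul_of_one_le_left' (one_le_pow₀ ha)
      _ = _ := by push_cast; ring

/-- If every transition moves by at most `L`, the process stays in the ball of radius `L t`. -/
theorem adaptiveMarginal_norm_gt_eq_zero {E : Type} [NormedAddCommGroup E] [MeasurableSpace E]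
    [OpensMeasurableSpace E] (P : Kernel (Y × E) E) [IsMarkovKernel P] (Q : AdaptationPlan Y E)
    (γ₀ : Y) (x₀ : E) {L : ℝ} (hP : ∀ γ x, ∀ᵐ y ∂P (γ, x), ‖y - x‖ ≤ L) (t : ℕ) :
    adaptiveMarginal P Q t γ₀ x₀ {x | ‖x₀‖ + L * t < ‖x‖} = 0 := by
  have hm : ∀ r : ℝ, MeasurableSet {x : E | r < ‖x‖} := fun r =>
    (isOpen_lt continuous_const continuous_norm).measurableSet
  induction t with
  | zero =>
    rw [← lintegral_indicator_one (hm _), lintegral_adaptiveMarginal_zero P Q γ₀ x₀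
      (measurable_one.indicator (hm _))]
    simp
  | succ t ih =>
    rw [← nonpos_iff_eq_zero, ← ih, ← lintegral_indicator_one (hm _),
      ← lintegral_indicator_one (hm _)]
    refine lintegral_adaptiveMarginal_succ_le P Q t γ₀ x₀ (measurable_one.indicator (hm _))
      (measurable_one.indicator (hm _)) fun γ x => ?_
    by_cases hx : ‖x₀‖ + L * t < ‖x‖
    · rw [Set.indicator_of_mem (by exact hx), lintegral_indicator_one (hm _)]
      exact prob_le_one
    · rw [lintegral_indicator_one (hm _), Set.indicator_of_notMem (by exact hx),
        nonpos_iff_eq_zero, measure_eq_zero_iff_ae_notMem]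
      filter_upwards [hP γ x] with y hy hy'
      have h1 := norm_add_le x (y - x)
      rw [add_sub_cancel] at h1
      have h2 : ‖x₀‖ + L * ((t + 1 : ℕ) : ℝ) < ‖y‖ := hy'
      push_cast at h2
      linarith [not_lt.1 hx]

end AdaptiveProcess

/-! ### Tails and the Wasserstein distance. -/

/-- Mass that `ν` puts outside a ball and `μ` does not has to travel. -/
theorem measure_norm_ge_le_wassersteinMinOne_add {E : Type} [NormedAddCommGroup E]
    [MeasurableSpace E] [OpensMeasurableSpace E] (μ ν : Measure E) (r : ℝ) :
    ν {x | r + 1 ≤ ‖x‖} ≤ wassersteinMinOne μ ν + μ {x | r < ‖x‖} := by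
  unfold wassersteinMinOne
  rw [ENNReal.iInf₂_add]
  refine le_iInf₂ fun ξ hξ => ?_
  obtain ⟨-, rfl, rfl⟩ := hξ
  have hA : MeasurableSet {x : E | r < ‖x‖} :=
    (isOpen_lt continuous_const continuous_norm).measurableSet
  have hB : MeasurableSet {x : E | r + 1 ≤ ‖x‖} :=
    (isClosed_le continuous_const continuous_norm).measurableSet
  rw [Measure.map_apply measurable_snd hB, Measure.map_apply measurable_fst hA,
    ← lintegral_indicator_one (measurable_snd hB), ← lintegral_indicator_one (measurable_fst hA),
    ← lintegral_add_right _ (measurable_one.indicator (measurable_fst hA))]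
  -- Pointwise under the coupling: if `p.2` has norm at least `r + 1`, then either `p.1` has norm
  -- above `r` or the two points are at least one apart and the cost is one.
  refine lintegral_mono fun p => ?_
  by_cases h2 : r + 1 ≤ ‖p.2‖
  · rw [Set.indicator_of_mem (by exact h2)]
    by_cases h1 : r < ‖p.1‖
    · rw [Set.indicator_of_mem (by exact h1)]
      exact le_add_self
    · refine le_add_right ?_
      rw [min_eq_right, ENNReal.ofReal_one, Pi.one_apply]
      rw [dist_comm, dist_eq_norm]
      linarith [norm_sub_norm_le p.2 p.1]
  · rw [Set.indicator_of_notMem (by exact h2)]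
    exact zero_le

/-! ### Increments and drift of the Metropolis kernel. -/

section Metropolis

variable {d : ℕ}

/-- The square root is self-adjoint, so the left side is the quadratic form of `γ` at `ξ`, which the
Loewner bound controls. -/
theorem norm_toEuclideanCLM_sqrt_sq_le {lo hi : ℝ} (hlo : 0 < lo) (γ : covarianceSet d lo hi)
    (ξ : EuclideanSpace ℝ (Fin d)) :
    ‖Matrix.toEuclideanCLM (𝕜 := ℝ) (CFC.sqrt γ.1) ξ‖ ^ 2 ≤ hi * ‖ξ‖ ^ 2 := by
  have h0 := covarianceSet_nonneg hlo γ
  have hs : star (CFC.sqrt γ.1) = CFC.sqrt γ.1 := (CFC.sqrt_nonneg γ.1).isSelfAdjoint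
  have h1 : inner ℝ (Matrix.toEuclideanCLM (𝕜 := ℝ) (CFC.sqrt γ.1) ξ)
      (Matrix.toEuclideanCLM (𝕜 := ℝ) (CFC.sqrt γ.1) ξ) =
      inner ℝ ξ (Matrix.toEuclideanCLM (𝕜 := ℝ) γ.1 ξ) := by
    conv_rhs => rw [← CFC.sqrt_mul_sqrt_self γ.1 h0, map_mul, mul_apply_eq_comp]
    rw [← ContinuousLinearMap.adjoint_inner_left, ← ContinuousLinearMap.star_eq_adjoint,
      ← map_star, hs, real_inner_comm]
  have h2 := (Matrix.le_iff.1 γ.2.2.1).dotProduct_mulVec_nonneg ξ.ofLp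
  have h3 : inner ℝ ξ (Matrix.toEuclideanCLM (𝕜 := ℝ) (hi • (1 : Matrix (Fin d) (Fin d) ℝ) - γ.1) ξ)
      = hi * ‖ξ‖ ^ 2 - inner ℝ ξ (Matrix.toEuclideanCLM (𝕜 := ℝ) γ.1 ξ) := by
    rw [map_sub, map_smul, map_one, sub_apply, inner_sub_right,
      smul_apply, one_apply_eq_self, inner_smul_right,
      real_inner_self_eq_norm_sq]
  have h4 : inner ℝ ξ (Matrix.toEuclideanCLM (𝕜 := ℝ) (hi • (1 : Matrix (Fin d) (Fin d) ℝ) - γ.1) ξ)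
      = star ξ.ofLp ⬝ᵥ ((hi • (1 : Matrix (Fin d) (Fin d) ℝ) - γ.1).mulVec ξ.ofLp) := by
    rw [EuclideanSpace.inner_eq_star_dotProduct, Matrix.ofLp_toEuclideanCLM, dotProduct_comm]
  rw [← real_inner_self_eq_norm_sq, h1]
  linarith

/-- The proposal increments are uniformly bounded. -/
theorem exists_norm_increment_le (q : ProposalDensity d) {lo : ℝ} (hlo : 0 < lo) (hi : ℝ) :
    ∃ L : ℝ, 0 < L ∧ ∀ (γ : covarianceSet d lo hi), ∀ ξ ∈ q.K,
      ‖Matrix.toEuclideanCLM (𝕜 := ℝ) (CFC.sqrt γ.1) ξ‖ ≤ L := by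
  obtain ⟨C, hC⟩ := q.isCompact_K.isBounded.exists_norm_le
  -- The sign of `hi` is not assumed, hence `|hi|`; the added one makes the bound strictly positive.
  refine ⟨Real.sqrt (|hi| * C ^ 2) + 1, by positivity, fun γ ξ hξ => ?_⟩
  refine (Real.le_sqrt_of_sq_le ?_).trans (le_add_of_nonneg_right zero_le_one)
  refine (norm_toEuclideanCLM_sqrt_sq_le hlo γ ξ).trans ?_
  gcongr
  · exact le_abs_self hi
  · exact hC ξ hξ

/-- Proposals from outside `K` have density zero, and the rejection atom does not move. -/
theorem ae_rwmMeasure_norm_sub_le (U : EuclideanSpace ℝ (Fin d) → ℝ) (hU : Measurable U)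
    (q : ProposalDensity d) (γ : Matrix (Fin d) (Fin d) ℝ) {L : ℝ} (hL : 0 ≤ L)
    (hγ : ∀ ξ ∈ q.K, ‖Matrix.toEuclideanCLM (𝕜 := ℝ) (CFC.sqrt γ) ξ‖ ≤ L)
    (x : EuclideanSpace ℝ (Fin d)) : ∀ᵐ y ∂rwmMeasure U q γ x, ‖y - x‖ ≤ L := by
  have hm : MeasurableSet {y : EuclideanSpace ℝ (Fin d) | ‖y - x‖ ≤ L}ᶜ :=
    (isClosed_le (by fun_prop) continuous_const).measurableSet.compl
  have h : rwmMeasure U q γ x {y | ‖y - x‖ ≤ L}ᶜ = 0 := by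
    rw [rwmMeasure_apply U hU q γ x hm, Set.indicator_of_notMem (a := x) (by simpa using hL),
      mul_zero, add_zero]
    refine (lintegral_congr fun ξ => ?_).trans lintegral_zero
    by_cases hξ : ξ ∈ q.K
    · rw [Set.indicator_of_notMem, zero_mul]
      simpa [proposalPoint] using hγ ξ hξ
    · rw [q.eq_zero ξ hξ, ENNReal.ofReal_zero, mul_zero]
  exact h

/-- Since `q.g` has total mass one, rejection is also an integral over proposals. Accepted and
rejected contributions can then be compared for each `ξ` separately. -/
theorem ofReal_rejection (U : EuclideanSpace ℝ (Fin d) → ℝ) (hU : Measurable U)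
    (q : ProposalDensity d) (γ : Matrix (Fin d) (Fin d) ℝ) (x : EuclideanSpace ℝ (Fin d)) :
    ENNReal.ofReal (rejection U q γ x) =
      ∫⁻ ξ, ENNReal.ofReal ((1 - acceptance U x (proposalPoint γ x ξ)) * q.g ξ) := by
  have hp := measurable_proposalPoint_right γ x
  have ha : Measurable (acceptance U x) := by unfold acceptance; fun_prop
  have hg := q.measurable_g
  have hgi : Integrable q.g :=
    (lintegral_ofReal_ne_top_iff_integrable hg.aestronglyMeasurable
      (Filter.Eventually.of_forall q.nonneg)).1 (by rw [q.lintegral_eq_one]; simp)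
  have hg1 : ∫ ξ, q.g ξ = 1 := by
    rw [integral_eq_lintegral_of_nonneg_ae (Filter.Eventually.of_forall q.nonneg)
      hg.aestronglyMeasurable, q.lintegral_eq_one, ENNReal.toReal_one]
  have hai : Integrable fun ξ => acceptance U x (proposalPoint γ x ξ) * q.g ξ := by
    refine hgi.mono' ((ha.comp hp).mul hg).aestronglyMeasurable
      (Filter.Eventually.of_forall fun ξ => ?_)
    rw [Real.norm_of_nonneg (mul_nonneg (acceptance_nonneg U x _) (q.nonneg ξ))]
    exact mul_le_of_le_one_left (q.nonneg ξ) (min_le_right _ _)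
  have hsub : ∀ ξ, (1 - acceptance U x (proposalPoint γ x ξ)) * q.g ξ =
      q.g ξ - acceptance U x (proposalPoint γ x ξ) * q.g ξ := fun ξ => by ring
  rw [rejection, ← ofReal_integral_eq_lintegral_ofReal]
  · simp_rw [hsub]
    rw [integral_sub hgi hai, hg1]
  · simp_rw [hsub]
    exact hgi.sub hai
  · exact Filter.Eventually.of_forall fun ξ =>
      mul_nonneg (sub_nonneg.2 (min_le_right _ _)) (q.nonneg ξ)

/-- A Metropolis step decreases the mean of increasing functions of the potential, compared with
the unadjusted random walk. -/
theorem lintegral_rwmMeasure_le (U : EuclideanSpace ℝ (Fin d) → ℝ) (hU : Measurable U)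
    (q : ProposalDensity d) (γ : Matrix (Fin d) (Fin d) ℝ) (x : EuclideanSpace ℝ (Fin d))
    {Φ : ℝ → ℝ≥0∞} (hΦ : Monotone Φ) :
    ∫⁻ y, Φ (U y) ∂rwmMeasure U q γ x ≤
      ∫⁻ ξ, Φ (U (proposalPoint γ x ξ)) * ENNReal.ofReal (q.g ξ) := by
  have hp := measurable_proposalPoint_right γ x
  have ha : Measurable (acceptance U x) := by unfold acceptance; fun_prop
  have hg := q.measurable_g
  have hF : Measurable fun y => Φ (U y) := hΦ.measurable.comp hU
  unfold rwmMeasure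
  rw [lintegral_add_measure, lintegral_map hF hp, lintegral_smul_measure, lintegral_dirac' _ hF,
    lintegral_withDensity_eq_lintegral_mul volume
      (f := fun ξ => ENNReal.ofReal (acceptance U x (proposalPoint γ x ξ) * q.g ξ))
      ((ha.comp hp).mul hg).ennreal_ofReal (g := fun ξ => Φ (U (proposalPoint γ x ξ)))
      (hF.comp hp),
    ofReal_rejection U hU, smul_eq_mul, ← lintegral_mul_const _ (by fun_prop),
    ← lintegral_add_right _ (by fun_prop)]
  refine lintegral_mono fun ξ => ?_
  simp only [Pi.mul_apply]
  set y := proposalPoint γ x ξ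
  have h0 := acceptance_nonneg U x y
  have h1 : 0 ≤ 1 - acceptance U x y := sub_nonneg.2 (min_le_right _ _)
  rw [ENNReal.ofReal_mul h0, ENNReal.ofReal_mul h1]
  -- An uphill proposal gives an average of `Φ (U y)` and the smaller `Φ (U x)`; a downhill proposal
  -- is always accepted.
  have key : ENNReal.ofReal (acceptance U x y) * Φ (U y) +
      ENNReal.ofReal (1 - acceptance U x y) * Φ (U x) ≤ Φ (U y) := by
    rcases le_total (U x) (U y) with h | h
    · calc _ ≤ ENNReal.ofReal (acceptance U x y) * Φ (U y) +
          ENNReal.ofReal (1 - acceptance U x y) * Φ (U y) := by gcongr; exact hΦ h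
        _ = _ := by rw [← add_mul, ← ENNReal.ofReal_add h0 h1]; simp
    · have : acceptance U x y = 1 :=
        min_eq_right (Real.one_le_exp (sub_nonneg.2 h))
      simp [this]
  calc _ = (ENNReal.ofReal (acceptance U x y) * Φ (U y) +
      ENNReal.ofReal (1 - acceptance U x y) * Φ (U x)) * ENNReal.ofReal (q.g ξ) := by ring
    _ ≤ _ := by gcongr

/-- Averaging a random-walk step over the symmetry `ξ ↦ -ξ`. -/
theorem lintegral_proposalPoint_le_of_symm (q : ProposalDensity d)
    (γ : Matrix (Fin d) (Fin d) ℝ) (x : EuclideanSpace ℝ (Fin d))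
    {F : EuclideanSpace ℝ (Fin d) → ℝ≥0∞} (hF : Measurable F) {b : ℝ≥0∞}
    (hb : ∀ ξ ∈ q.K, F (x + Matrix.toEuclideanCLM (𝕜 := ℝ) (CFC.sqrt γ) ξ) +
      F (x - Matrix.toEuclideanCLM (𝕜 := ℝ) (CFC.sqrt γ) ξ) ≤ 2 * b) :
    ∫⁻ ξ, F (proposalPoint γ x ξ) * ENNReal.ofReal (q.g ξ) ≤ b := by
  have hp := measurable_proposalPoint_right γ x
  have hg := q.measurable_g
  have h2 : ∫⁻ ξ, F (proposalPoint γ x ξ) * ENNReal.ofReal (q.g ξ) =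
      ∫⁻ ξ, F (proposalPoint γ x (-ξ)) * ENNReal.ofReal (q.g ξ) := by
    rw [← lintegral_neg_eq_self]
    refine lintegral_congr fun ξ => ?_
    rw [q.radial (-ξ) ξ (norm_neg ξ)]
  have h3 : 2 * ∫⁻ ξ, F (proposalPoint γ x ξ) * ENNReal.ofReal (q.g ξ) ≤ 2 * b := by
    rw [two_mul]
    nth_rw 2 [h2]
    rw [← lintegral_add_left (by fun_prop)]
    calc _ ≤ ∫⁻ ξ, 2 * b * ENNReal.ofReal (q.g ξ) := lintegral_mono fun ξ => ?_
      _ = 2 * b := by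
        rw [lintegral_const_mul _ hg.ennreal_ofReal, q.lintegral_eq_one, mul_one]
    by_cases hξ : ξ ∈ q.K
    · rw [← add_mul]
      gcongr
      simpa [proposalPoint, sub_eq_add_neg] using hb ξ hξ
    · simp [q.eq_zero ξ hξ]
  exact (ENNReal.mul_le_mul_iff_right (by simp) (by simp)).1 h3

end Metropolis

/-! ### Second-order expansion of `exp (s U)`. -/

section Potential

variable {d : ℕ}

/-- Each of the `d ^ 2` entries is at most the Frobenius norm; this crude count suffices, as only
the power of `‖z‖` matters later. -/
theorem norm_fderiv_fderiv_le {U : EuclideanSpace ℝ (Fin d) → ℝ} (hU : ContDiff ℝ 2 U)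
    (z : EuclideanSpace ℝ (Fin d)) :
    ‖fderiv ℝ (fderiv ℝ U) z‖ ≤ (d : ℝ) ^ 2 * frobeniusNorm (hessianMatrix U z) := by
  have hd : DifferentiableAt ℝ (fderiv ℝ U) z :=
    (hU.fderiv_right (m := 1) (by norm_num)).differentiable (by norm_num) z
  set F := frobeniusNorm (hessianMatrix U z) with hF
  have hF0 : 0 ≤ F := Real.sqrt_nonneg _
  have hentry : ∀ i j, |fderiv ℝ (fderiv ℝ U) z (EuclideanSpace.single i 1)
      (EuclideanSpace.single j 1)| ≤ F := by
    intro i j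
    have h1 : hessianMatrix U z i j = fderiv ℝ (fderiv ℝ U) z (EuclideanSpace.single i 1)
        (EuclideanSpace.single j 1) := by
      simp only [hessianMatrix, Matrix.of_apply]
      rw [fderiv_clm_apply hd (by fun_prop)]
      simp
    rw [← h1, hF, frobeniusNorm]
    refine Real.le_sqrt_of_sq_le ?_
    rw [sq_abs]
    calc hessianMatrix U z i j ^ 2 ≤ ∑ j, hessianMatrix U z i j ^ 2 :=
          Finset.single_le_sum (f := fun j => hessianMatrix U z i j ^ 2)
            (fun _ _ => sq_nonneg _) (Finset.mem_univ j)
      _ ≤ _ := Finset.single_le_sum (f := fun i => ∑ j, hessianMatrix U z i j ^ 2)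
            (fun _ _ => Finset.sum_nonneg fun _ _ => sq_nonneg _) (Finset.mem_univ i)
  have hsum : ∀ v : EuclideanSpace ℝ (Fin d), v = ∑ i, v i • EuclideanSpace.single i (1 : ℝ) :=
    fun v => by
      ext k
      simp [Finset.sum_apply, Pi.single_apply]
  refine ContinuousLinearMap.opNorm_le_bound₂ _ (by positivity) fun v w => ?_
  conv_lhs => rw [hsum v, hsum w]
  simp only [map_sum, map_smul, sum_apply, smul_apply, smul_eq_mul]
  refine (norm_sum_le _ _).trans ?_
  calc _ ≤ ∑ _i : Fin d, ∑ _j : Fin d, ‖v‖ * ‖w‖ * F := by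
        refine Finset.sum_le_sum fun i _ => ?_
        rw [Finset.mul_sum]
        refine (norm_sum_le _ _).trans (Finset.sum_le_sum fun j _ => ?_)
        rw [norm_mul, norm_mul]
        calc _ ≤ ‖w‖ * (‖v‖ * F) :=
              mul_le_mul (PiLp.norm_apply_le w i) (mul_le_mul (PiLp.norm_apply_le v j)
                (hentry j i) (abs_nonneg _) (norm_nonneg _)) (by positivity) (norm_nonneg _)
          _ = _ := by ring
    _ = _ := by simp; ring

theorem abs_sub_le_of_norm_fderiv_le {U : EuclideanSpace ℝ (Fin d) → ℝ} (hU : Differentiable ℝ U)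
    {x h : EuclideanSpace ℝ (Fin d)} {L G : ℝ} (hG0 : 0 ≤ G)
    (hG : ∀ z, ‖z - x‖ ≤ L → ‖fderiv ℝ U z‖ ≤ G) (hh : ‖h‖ ≤ L) :
    |U (x + h) - U x| ≤ G * L := by
  have := (convex_closedBall x L).norm_image_sub_le_of_norm_fderiv_le (𝕜 := ℝ) (f := U)
    (fun z _ => hU z) (fun z hz => hG z (by simpa [dist_eq_norm] using hz))
    (Metric.mem_closedBall_self ((norm_nonneg h).trans hh))
    (show x + h ∈ Metric.closedBall x L by simpa [dist_eq_norm] using hh)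
  rw [Real.norm_eq_abs, add_sub_cancel_left] at this
  exact this.trans (by gcongr)

/-- The map `k ↦ U (x + k) + U (x - k)` has derivative `fderiv ℝ U (x + k) - fderiv ℝ U (x - k)`, of
norm at most `2 * H * L` on the ball. Two mean value inequalities replace a Taylor formula. -/
theorem second_difference_le {U : EuclideanSpace ℝ (Fin d) → ℝ} (hU : ContDiff ℝ 2 U)
    {x h : EuclideanSpace ℝ (Fin d)} {L H : ℝ} (hH0 : 0 ≤ H)
    (hH : ∀ z, ‖z - x‖ ≤ L → ‖fderiv ℝ (fderiv ℝ U) z‖ ≤ H) (hh : ‖h‖ ≤ L) :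
    U (x + h) + U (x - h) - 2 * U x ≤ 2 * H * L ^ 2 := by
  have hL : 0 ≤ L := (norm_nonneg h).trans hh
  have hU1 : Differentiable ℝ U := hU.differentiable (by norm_num)
  have hU2 : Differentiable ℝ (fderiv ℝ U) :=
    (hU.fderiv_right (m := 1) (by norm_num)).differentiable (by norm_num)
  have hT : ∀ k : EuclideanSpace ℝ (Fin d), HasFDerivAt (fun k => U (x + k) + U (x - k))
      (fderiv ℝ U (x + k) - fderiv ℝ U (x - k)) k := by
    intro k
    have h1 := ((hU1 (x + k)).hasFDerivAt.comp k ((hasFDerivAt_id k).const_add x)).add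
      ((hU1 (x - k)).hasFDerivAt.comp k ((hasFDerivAt_id k).const_sub x))
    convert! h1 using 1
    ext v
    simp [sub_eq_add_neg]
  have hb : ∀ k ∈ Metric.closedBall (0 : EuclideanSpace ℝ (Fin d)) L,
      ‖fderiv ℝ U (x + k) - fderiv ℝ U (x - k)‖ ≤ H * (2 * L) := by
    intro k hk
    have hk' : ‖k‖ ≤ L := by simpa using hk
    have := (convex_closedBall x L).norm_image_sub_le_of_norm_fderiv_le (𝕜 := ℝ)
      (f := fderiv ℝ U) (fun z _ => hU2 z) (fun z hz => hH z (by simpa [dist_eq_norm] using hz))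
      (show x - k ∈ Metric.closedBall x L by simpa [dist_eq_norm] using hk')
      (show x + k ∈ Metric.closedBall x L by simpa [dist_eq_norm] using hk')
    refine this.trans ?_
    gcongr
    calc ‖x + k - (x - k)‖ = ‖k + k‖ := by congr 1; abel
      _ ≤ 2 * L := by linarith [norm_add_le k k]
  have := (convex_closedBall (0 : EuclideanSpace ℝ (Fin d)) L).norm_image_sub_le_of_norm_hasFDerivWithin_le
    (𝕜 := ℝ) (fun k _ => (hT k).hasFDerivWithinAt) hb (Metric.mem_closedBall_self hL)
    (show h ∈ Metric.closedBall 0 L by simpa using hh)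
  simp only [add_zero, sub_zero, Real.norm_eq_abs] at this
  have h3 := (le_abs_self _).trans this
  have h4 : H * (2 * L) * ‖h‖ ≤ H * (2 * L) * L := by gcongr
  nlinarith

/-- From `exp a ≤ 1 + a + a ^ 2` for `|a| ≤ 1`. The linear terms enter only through their sum, so
opposite increments cancel to first order. -/
theorem exp_add_exp_le {a b δ η : ℝ} (ha : |a| ≤ δ) (hb : |b| ≤ δ) (hδ : δ ≤ 1)
    (hab : a + b ≤ η) : Real.exp a + Real.exp b ≤ 2 + η + 2 * δ ^ 2 := by
  have h1 := (abs_le.1 (Real.abs_exp_sub_one_sub_id_le (ha.trans hδ))).2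
  have h2 := (abs_le.1 (Real.abs_exp_sub_one_sub_id_le (hb.trans hδ))).2
  have h3 := sq_le_sq' (abs_le.1 ha).1 (abs_le.1 ha).2
  have h4 := sq_le_sq' (abs_le.1 hb).1 (abs_le.1 hb).2
  linarith

theorem monotone_ofReal_exp_mul {s : ℝ} (hs : 0 ≤ s) :
    Monotone fun u : ℝ => ENNReal.ofReal (Real.exp (s * u)) := fun _ _ h =>
  ENNReal.ofReal_le_ofReal (Real.exp_le_exp.2 (by gcongr))

/-- Second-order drift of `exp (s U)` under a Metropolis step. -/
theorem lintegral_exp_rwmMeasure_le {U : EuclideanSpace ℝ (Fin d) → ℝ} (hU : ContDiff ℝ 2 U)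
    (q : ProposalDensity d) (γ : Matrix (Fin d) (Fin d) ℝ) {L : ℝ}
    (hγ : ∀ ξ ∈ q.K, ‖Matrix.toEuclideanCLM (𝕜 := ℝ) (CFC.sqrt γ) ξ‖ ≤ L)
    (x : EuclideanSpace ℝ (Fin d)) {s G H : ℝ} (hs : 0 ≤ s) (hG0 : 0 ≤ G)
    (hH0 : 0 ≤ H) (hG : ∀ z, ‖z - x‖ ≤ L → ‖fderiv ℝ U z‖ ≤ G)
    (hH : ∀ z, ‖z - x‖ ≤ L → ‖fderiv ℝ (fderiv ℝ U) z‖ ≤ H) (hsG : s * (G * L) ≤ 1) :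
    ∫⁻ y, ENNReal.ofReal (Real.exp (s * U y)) ∂rwmMeasure U q γ x ≤
      ENNReal.ofReal (1 + s * H * L ^ 2 + (s * (G * L)) ^ 2) *
        ENNReal.ofReal (Real.exp (s * U x)) := by
  have hm : Measurable U := hU.continuous.measurable
  refine (lintegral_rwmMeasure_le U hm q γ x (monotone_ofReal_exp_mul hs)).trans ?_
  refine lintegral_proposalPoint_le_of_symm q γ x (F := fun y => ENNReal.ofReal
    (Real.exp (s * U y))) (by fun_prop) fun ξ hξ => ?_
  set h := Matrix.toEuclideanCLM (𝕜 := ℝ) (CFC.sqrt γ) ξ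
  have hh : ‖h‖ ≤ L := hγ ξ hξ
  have hd : Differentiable ℝ U := hU.differentiable (by norm_num)
  have h1 := abs_sub_le_of_norm_fderiv_le hd hG0 hG hh
  have h2 := abs_sub_le_of_norm_fderiv_le hd hG0 hG (h := -h) (by rwa [norm_neg])
  rw [← sub_eq_add_neg] at h2
  have h3 := second_difference_le hU hH0 hH hh
  -- `δ` is the first-order size of the increments of `s U`, and `η` bounds their symmetric sum
  -- through the Hessian.
  have h4 := exp_add_exp_le (a := s * (U (x + h) - U x)) (b := s * (U (x - h) - U x))
    (δ := s * (G * L)) (η := s * (2 * H * L ^ 2))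
    (by rw [abs_mul, abs_of_nonneg hs]; gcongr) (by rw [abs_mul, abs_of_nonneg hs]; gcongr) hsG
    (by rw [← mul_add]; gcongr; linarith)
  have h5 : ∀ y, Real.exp (s * U y) = Real.exp (s * (U y - U x)) * Real.exp (s * U x) := fun y => by
    rw [← Real.exp_add]; ring_nf
  have h6 : ∀ r : ℝ, 2 * ENNReal.ofReal r = ENNReal.ofReal (2 * r) := fun r => by
    rw [ENNReal.ofReal_mul zero_le_two]; simp
  rw [← ENNReal.ofReal_add (Real.exp_pos _).le (Real.exp_pos _).le,
    ← ENNReal.ofReal_mul (by positivity), h6, h5 (x + h),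
    h5 (x - h), ← add_mul, ← mul_assoc]
  refine ENNReal.ofReal_le_ofReal ?_
  gcongr
  linarith

end Potential

/-! ### Growth of the potential and tails of the target. -/

open Filter Topology in
theorem eventually_mul_rpow_le_exp_rpow (C s : ℝ) {b m : ℝ} (hb : 0 < b) (hm : 0 < m) :
    ∀ᶠ σ : ℝ in atTop, C * σ ^ s ≤ Real.exp (b * σ ^ m) := by
  have h1 := (isLittleO_rpow_exp_pos_mul_atTop (s / m) hb).comp_tendsto (tendsto_rpow_atTop hm)
  have hC : (0 : ℝ) < (|C| + 1)⁻¹ := by positivity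
  filter_upwards [h1.bound hC, eventually_gt_atTop 0] with σ hσ hσ0
  simp only [Function.comp_apply, ← Real.rpow_mul hσ0.le, mul_div_cancel₀ s hm.ne'] at hσ
  rw [Real.norm_of_nonneg (by positivity), Real.norm_of_nonneg (Real.exp_pos _).le,
    inv_mul_eq_div, le_div_iff₀ (by positivity)] at hσ
  have : C * σ ^ s ≤ (|C| + 1) * σ ^ s := by
    gcongr
    linarith [le_abs_self C]
  linarith

section Growth

variable {d : ℕ} {U : EuclideanSpace ℝ (Fin d) → ℝ} {m : ℝ}

theorem PotentialRegularity.exists_le_mul_rpow (hU : PotentialRegularity U m) (hm : 0 < m) :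
    ∃ D : ℝ, 0 < D ∧ ∀ σ : ℝ, 1 ≤ σ → ∀ y, ‖y‖ ≤ σ → U y ≤ D * σ ^ m := by
  obtain ⟨_, _, _, D, _, _, _, R, _, _, _, hD, _, _, _, hR, h⟩ := hU.growth
  obtain ⟨C, hC⟩ := (isCompact_closedBall (0 : EuclideanSpace ℝ (Fin d)) R).exists_bound_of_continuousOn
    hU.contDiff.continuous.continuousOn
  refine ⟨max D C, lt_max_of_lt_left hD, fun σ hσ y hy => ?_⟩
  rcases le_total R ‖y‖ with hRy | hRy
  · calc U y ≤ D * ‖y‖ ^ m := (h y hRy).1.2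
      _ ≤ max D C * σ ^ m := by
        gcongr
        exact le_max_left _ _
  · have h1 : U y ≤ C := (le_abs_self _).trans (hC y (by simpa using hRy))
    have h2 : (1 : ℝ) ≤ σ ^ m := Real.one_le_rpow hσ hm.le
    calc U y ≤ max D C := h1.trans (le_max_right _ _)
      _ ≤ max D C * σ ^ m := le_mul_of_one_le_right (hD.le.trans (le_max_left _ _)) h2

-- The growth bound makes `exp (-U)` smaller than `(1 + ‖x‖) ^ (-(d + 1))` far out. Integrability
-- makes the normalising integral positive, rather than the default zero.
open Filter in
theorem PotentialRegularity.integrable_exp_neg (hU : PotentialRegularity U m) (hm : 0 < m) :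
    Integrable fun x => Real.exp (-U x) := by
  obtain ⟨d₁, _, _, _, _, _, _, R, hd₁, _, _, _, _, _, _, hR, h⟩ := hU.growth
  have hint := integrable_one_add_norm (E := EuclideanSpace ℝ (Fin d))
    (μ := volume) (r := (d : ℝ) + 1) (by simp)
  have hc : Continuous fun x => Real.exp (-U x) := Real.continuous_exp.comp hU.contDiff.continuous.neg
  refine hc.locallyIntegrable.integrable_of_isBigO_cocompact (g := fun x =>
    (1 + ‖x‖) ^ (-((d : ℝ) + 1))) ?_ (hint.integrableAtFilter _)
  refine Asymptotics.IsBigO.of_bound 1 ?_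
  have hn := tendsto_norm_cocompact_atTop (E := EuclideanSpace ℝ (Fin d))
  filter_upwards [hn.eventually (eventually_mul_rpow_le_exp_rpow (2 ^ ((d : ℝ) + 1)) (d + 1) hd₁ hm),
    hn.eventually (eventually_ge_atTop R), hn.eventually (eventually_ge_atTop 1)] with x h1 h2 h3
  rw [Real.norm_of_nonneg (Real.exp_pos _).le, Real.norm_of_nonneg (by positivity), one_mul,
    Real.exp_neg, Real.rpow_neg (by positivity)]
  gcongr
  calc (1 + ‖x‖) ^ ((d : ℝ) + 1) ≤ (2 * ‖x‖) ^ ((d : ℝ) + 1) := by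
        gcongr
        linarith
    _ = 2 ^ ((d : ℝ) + 1) * ‖x‖ ^ ((d : ℝ) + 1) := Real.mul_rpow (by norm_num) (norm_nonneg x)
    _ ≤ _ := h1.trans (Real.exp_le_exp.2 (h x h2).1.1)

/-- Lower bound on the tails of the target. -/
theorem gibbsMeasure_norm_ge (hd : 1 ≤ d) (hU : PotentialRegularity U m) (hm : 0 < m) {D : ℝ}
    (hD : ∀ σ : ℝ, 1 ≤ σ → ∀ y, ‖y‖ ≤ σ → U y ≤ D * σ ^ m) :
    ∃ κ : ℝ, 0 < κ ∧ ∀ r : ℝ, 0 ≤ r →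
      ENNReal.ofReal (κ * Real.exp (-(D * (r + 2) ^ m))) ≤ gibbsMeasure U {x | r ≤ ‖x‖} := by
  have hZ : 0 < ∫ y, Real.exp (-U y) := integral_exp_pos (hU.integrable_exp_neg hm)
  set Z := ∫ y, Real.exp (-U y)
  set v := (volume (Metric.closedBall (0 : EuclideanSpace ℝ (Fin d)) 1)) with hv
  have hv0 : v ≠ 0 := (Metric.measure_closedBall_pos volume _ one_pos).ne'
  have hvt : v ≠ ⊤ := measure_closedBall_lt_top.ne
  refine ⟨v.toReal / Z, div_pos (ENNReal.toReal_pos hv0 hvt) hZ, fun r hr => ?_⟩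
  -- A unit vector exists because `1 ≤ d`. The unit ball around `(r + 1) • e` lies where `r ≤ ‖x‖ ≤
  -- r + 2`, so the density there is bounded below.
  set e : EuclideanSpace ℝ (Fin d) := EuclideanSpace.single ⟨0, hd⟩ 1
  have he : ‖(r + 1) • e‖ = r + 1 := by
    rw [norm_smul, Real.norm_of_nonneg (by positivity), PiLp.norm_single]
    simp
  have hB : Metric.closedBall ((r + 1) • e) 1 ⊆ {x | r ≤ ‖x‖} := by
    intro y hy
    rw [Metric.mem_closedBall, dist_comm, dist_eq_norm] at hy
    have := norm_sub_norm_le ((r + 1) • e) y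
    show r ≤ ‖y‖
    linarith
  refine le_trans ?_ (measure_mono hB)
  unfold gibbsMeasure
  rw [withDensity_apply _ measurableSet_closedBall]
  calc _ = ∫⁻ _ in Metric.closedBall ((r + 1) • e) 1,
        ENNReal.ofReal (Real.exp (-(D * (r + 2) ^ m)) / Z) := by
        rw [setLIntegral_const, Measure.addHaar_closedBall_center, ← hv,
          ← ENNReal.ofReal_toReal hvt, ← ENNReal.ofReal_mul (by positivity)]
        congr 1
        simp only [ENNReal.toReal_ofReal ENNReal.toReal_nonneg]
        ring
    _ ≤ _ := by
        refine setLIntegral_mono' measurableSet_closedBall fun y hy => ?_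
        rw [Metric.mem_closedBall, dist_eq_norm] at hy
        have h1 := norm_sub_norm_le y ((r + 1) • e)
        have h2 := hD (r + 2) (by linarith) y (by linarith)
        refine ENNReal.ofReal_le_ofReal ?_
        gcongr

open Filter in
/-- A process whose tail at distance `B σ` is negligible with respect to that of the target is at
distance at least `exp (-c σ ^ m)` from the target. -/
theorem exists_exp_le_wassersteinMinOne (hd : 1 ≤ d) (hU : PotentialRegularity U m) (hm : 0 < m)
    {D B : ℝ} (hD : ∀ σ : ℝ, 1 ≤ σ → ∀ y, ‖y‖ ≤ σ → U y ≤ D * σ ^ m) (hD0 : 0 < D)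
    (hB : 0 ≤ B) :
    ∃ c : ℝ, 0 < c ∧ ∀ᶠ σ : ℝ in atTop, ∀ μ : Measure (EuclideanSpace ℝ (Fin d)),
      μ {x | B * σ < ‖x‖} ≤ ENNReal.ofReal (Real.exp (-(D * ((B + 1) * σ) ^ m + σ ^ m))) →
      ENNReal.ofReal (Real.exp (-c * σ ^ m)) ≤ wassersteinMinOne μ (gibbsMeasure U) := by
  obtain ⟨κ, hκ, htail⟩ := gibbsMeasure_norm_ge hd hU hm hD
  refine ⟨D * (B + 1) ^ m + 1, by positivity, ?_⟩
  -- The bound `σ ≥ 3` gives `B * σ + 3 ≤ (B + 1) * σ`; `2 / κ ≤ exp (σ ^ m)` makes the tail of `μ`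
  -- at most half of the lower bound for the target's tail.
  filter_upwards [eventually_mul_rpow_le_exp_rpow (2 / κ) 0 one_pos hm, eventually_ge_atTop 3]
    with σ h1 h3 μ hμ
  rw [Real.rpow_zero, mul_one, one_mul, div_le_iff₀ hκ] at h1
  have hσ : 0 ≤ σ := by linarith
  set X := D * ((B + 1) * σ) ^ m with hX
  have h2 : ENNReal.ofReal (κ * Real.exp (-X)) ≤
      wassersteinMinOne μ (gibbsMeasure U) + ENNReal.ofReal (Real.exp (-(X + σ ^ m))) := by
    refine le_trans ?_ ((measure_norm_ge_le_wassersteinMinOne_add μ (gibbsMeasure U) (B * σ)).trans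
      (by gcongr))
    refine le_trans (ENNReal.ofReal_le_ofReal ?_) (htail _ (by positivity))
    rw [hX]
    gcongr
    linarith
  have h4 : Real.exp (-(D * (B + 1) ^ m + 1) * σ ^ m) = Real.exp (-(X + σ ^ m)) := by
    rw [hX, Real.mul_rpow (by positivity) hσ]
    ring_nf
  rw [h4]
  have h5 : Real.exp (-(X + σ ^ m)) + Real.exp (-(X + σ ^ m)) ≤ κ * Real.exp (-X) := by
    have h6 : Real.exp (-X) = Real.exp (-(X + σ ^ m)) * Real.exp (σ ^ m) := by
      rw [← Real.exp_add]; ring_nf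
    rw [h6]
    nlinarith [Real.exp_pos (-(X + σ ^ m))]
  have h7 := (ENNReal.ofReal_le_ofReal h5).trans h2
  rw [ENNReal.ofReal_add (Real.exp_pos _).le (Real.exp_pos _).le] at h7
  exact (ENNReal.add_le_add_iff_right ENNReal.ofReal_ne_top).1 h7

end Growth

/-! ### Lower bounds at scale `σ`. -/

section LowerBound

variable {d : ℕ} {U : EuclideanSpace ℝ (Fin d) → ℝ} {m : ℝ}

open Filter in
/-- Drift of `exp (s U)` for sublinear potentials: of second order away from the origin. -/
theorem PotentialRegularity.exists_drift (hU : PotentialRegularity U m) (hm : 0 < m) (hm₁ : m < 1)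
    (q : ProposalDensity d) {lo : ℝ} (hlo : 0 < lo) (hi : ℝ) {D s : ℝ} (hs : 0 < s)
    (hD : ∀ σ : ℝ, 1 ≤ σ → ∀ y, ‖y‖ ≤ σ → U y ≤ D * σ ^ m) :
    ∃ C : ℝ, 0 < C ∧ ∀ᶠ σ : ℝ in atTop, ∀ (γ : covarianceSet d lo hi) x,
      ∫⁻ y, ENNReal.ofReal (Real.exp (s * U y)) ∂rwmMeasure U q γ.1 x ≤
        ENNReal.ofReal (1 + C * σ ^ (2 * m - 2)) * ENNReal.ofReal (Real.exp (s * U x)) +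
          ENNReal.ofReal (Real.exp (s * (D * (3 * σ) ^ m))) := by
  obtain ⟨L, hL, hγ⟩ := exists_norm_increment_le q hlo hi
  obtain ⟨_, _, _, _, D₂, D₃, _, R, _, _, _, _, hD₂, hD₃, _, hR, h⟩ := hU.growth
  refine ⟨s * ((d : ℝ) ^ 2 * D₃) * L ^ 2 + (s * (D₂ * L)) ^ 2, by positivity, ?_⟩
  -- Here `m < 1` enters: the increments of `s U` far out tend to zero for every fixed `s`, so the
  -- exponential can be expanded.
  have hsmall := (tendsto_rpow_neg_atTop (sub_pos.2 hm₁)).const_mul (s * (D₂ * L))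
  rw [mul_zero] at hsmall
  filter_upwards [eventually_ge_atTop R, eventually_ge_atTop L, eventually_ge_atTop 1,
    hsmall.eventually_le_const one_pos] with σ hσR hσL hσ1 hσs γ x
  have hσ0 : 0 < σ := by linarith
  rw [neg_sub] at hσs
  -- As `L ≤ σ`, a step from beyond `2 * σ` only sees points beyond `σ`, where the derivative bounds
  -- hold; any other step ends within `3 * σ` and is paid for by the additive term.
  rcases le_total (2 * σ) ‖x‖ with hx | hx
  · refine le_trans ?_ le_self_add
    have hfar : ∀ z, ‖z - x‖ ≤ L → σ ≤ ‖z‖ := fun z hz => by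
      have := norm_sub_norm_le x z
      rw [norm_sub_rev] at this
      linarith
    refine (lintegral_exp_rwmMeasure_le hU.contDiff q γ.1 (hγ γ) x hs.le
      (G := D₂ * σ ^ (m - 1)) (H := (d : ℝ) ^ 2 * (D₃ * σ ^ (m - 2))) (by positivity)
      (by positivity) (fun z hz => ?_) (fun z hz => ?_) ?_).trans ?_
    · have hz' := hfar z hz
      have h1 : ‖gradient U z‖ = ‖fderiv ℝ U z‖ := by simp [gradient]
      rw [← h1]
      refine (h z (hσR.trans hz')).2.1.2.trans ?_
      gcongr ?_ * ?_
      exact Real.rpow_le_rpow_of_nonpos hσ0 hz' (by linarith)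
    · have hz' := hfar z hz
      refine (norm_fderiv_fderiv_le hU.contDiff z).trans ?_
      gcongr
      refine (h z (hσR.trans hz')).2.2.2.2.trans ?_
      gcongr ?_ * ?_
      exact Real.rpow_le_rpow_of_nonpos hσ0 hz' (by linarith)
    · calc _ = s * (D₂ * L) * σ ^ (m - 1) := by ring
        _ ≤ 1 := hσs
    · gcongr ENNReal.ofReal ?_ * _
      have h1 : (σ ^ (m - 1)) ^ 2 = σ ^ (2 * m - 2) := by
        rw [← Real.rpow_natCast, ← Real.rpow_mul hσ0.le]
        congr 1
        push_cast
        ring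
      have h2 : σ ^ (m - 2) ≤ σ ^ (2 * m - 2) := Real.rpow_le_rpow_of_exponent_le hσ1 (by linarith)
      calc _ = 1 + (s * ((d : ℝ) ^ 2 * D₃) * L ^ 2 * σ ^ (m - 2) +
            (s * (D₂ * L)) ^ 2 * (σ ^ (m - 1)) ^ 2) := by ring
        _ ≤ 1 + (s * ((d : ℝ) ^ 2 * D₃) * L ^ 2 * σ ^ (2 * m - 2) +
            (s * (D₂ * L)) ^ 2 * σ ^ (2 * m - 2)) := by
          rw [h1]
          gcongr
        _ = _ := by ring
  · refine le_trans ?_ le_add_self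
    have := isProbabilityMeasure_rwmMeasure U hU.contDiff.continuous.measurable q γ.1 x
    calc _ ≤ ∫⁻ _, ENNReal.ofReal (Real.exp (s * (D * (3 * σ) ^ m))) ∂rwmMeasure U q γ.1 x := by
          refine lintegral_mono_ae ?_
          filter_upwards [ae_rwmMeasure_norm_sub_le U hU.contDiff.continuous.measurable q γ.1 hL.le
            (hγ γ) x] with y hy
          have h1 := norm_sub_norm_le y x
          have h2 := hD (3 * σ) (by linarith) y (by linarith)
          gcongr
      _ = _ := by simp

open Filter in
/-- Exponential moments of the adaptive process for sublinear potentials. -/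
theorem PotentialRegularity.exists_moment_bound (hU : PotentialRegularity U m) (hm : 0 < m)
    (hm₁ : m < 1) (q : ProposalDensity d) {lo : ℝ} (hlo : 0 < lo) (hi : ℝ) {D s : ℝ} (hs : 0 < s)
    (hD0 : 0 < D) (hD : ∀ σ : ℝ, 1 ≤ σ → ∀ y, ‖y‖ ≤ σ → U y ≤ D * σ ^ m) :
    ∃ C : ℝ, 0 < C ∧ ∀ᶠ σ : ℝ in atTop, ∀ (x₀ : EuclideanSpace ℝ (Fin d)), ‖x₀‖ ≤ σ →
      ∀ (γ₀ : covarianceSet d lo hi) (t : ℕ), (t : ℝ) ≤ σ ^ (2 - m) → ∀ Q,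
        ∫⁻ x, ENNReal.ofReal (Real.exp (s * U x))
          ∂adaptiveMarginal (rwmKernel U hU.contDiff.continuous.measurable q hlo hi) Q t γ₀ x₀ ≤
        ENNReal.ofReal (Real.exp (C * σ ^ m)) := by
  obtain ⟨C, hC, hdrift⟩ := hU.exists_drift hm hm₁ q hlo hi hs hD
  have hUm := hU.contDiff.continuous.measurable
  -- The summands pay for the accumulated factor, for the starting value and additive terms, and for
  -- the count `1 + t ≤ exp (σ ^ m)`.
  refine ⟨C + s * (D * 3 ^ m) + 1, by positivity, ?_⟩
  filter_upwards [hdrift, eventually_ge_atTop 1,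
    eventually_mul_rpow_le_exp_rpow 2 (2 - m) one_pos hm] with σ hσ hσ1 hσe x₀ hx₀ γ₀ t ht Q
  rw [one_mul] at hσe
  have hσ0 : 0 < σ := by linarith
  refine (lintegral_adaptiveMarginal_le_of_drift _ Q γ₀ x₀ (by fun_prop)
    (ENNReal.one_le_ofReal.2 (le_add_of_nonneg_right (by positivity))) hσ t).trans ?_
  rw [← ENNReal.ofReal_natCast, ← ENNReal.ofReal_mul (by positivity),
    ← ENNReal.ofReal_add (by positivity) (by positivity), ← ENNReal.ofReal_pow (by positivity),
    ← ENNReal.ofReal_mul (by positivity)]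
  refine ENNReal.ofReal_le_ofReal ?_
  have h1 : (1 + C * σ ^ (2 * m - 2)) ^ t ≤ Real.exp (C * σ ^ m) := by
    have h2 : C * σ ^ (2 * m - 2) * t ≤ C * σ ^ m := by
      calc _ ≤ C * σ ^ (2 * m - 2) * σ ^ (2 - m) := by gcongr
        _ = C * σ ^ m := by
          rw [mul_assoc, ← Real.rpow_add hσ0]
          ring_nf
    calc _ ≤ Real.exp (C * σ ^ (2 * m - 2)) ^ t := by
          gcongr
          linarith [Real.add_one_le_exp (C * σ ^ (2 * m - 2))]
      _ = Real.exp (C * σ ^ (2 * m - 2) * t) := by rw [← Real.exp_nat_mul, mul_comm]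
      _ ≤ _ := Real.exp_le_exp.2 h2
  have h3 : Real.exp (s * U x₀) ≤ Real.exp (s * (D * (3 * σ) ^ m)) := by
    have := hD (3 * σ) (by linarith) x₀ (by linarith)
    gcongr
  have h4 : (1 : ℝ) + t ≤ Real.exp (σ ^ m) := by
    have : (1 : ℝ) ≤ σ ^ (2 - m) := Real.one_le_rpow hσ1 (by linarith)
    linarith
  calc _ ≤ Real.exp (C * σ ^ m) * (Real.exp (s * (D * (3 * σ) ^ m)) * (1 + t)) := by
        gcongr
        linarith
    _ ≤ Real.exp (C * σ ^ m) * (Real.exp (s * (D * (3 * σ) ^ m)) * Real.exp (σ ^ m)) := by gcongr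
    _ = _ := by
        rw [← Real.exp_add, ← Real.exp_add, Real.mul_rpow (by norm_num) hσ0.le]
        ring_nf

open Filter in
/-- Lower bound for sublinear potentials, on the diffusive scale `t ≤ σ ^ (2 - m)`. -/
theorem PotentialRegularity.exists_lower_bound_of_lt_one (hd : 1 ≤ d)
    (hU : PotentialRegularity U m) (hm : 0 < m) (hm₁ : m < 1)
    (q : ProposalDensity d) {lo : ℝ} (hlo : 0 < lo) (hi : ℝ) :
    ∃ c : ℝ, 0 < c ∧ ∀ᶠ σ : ℝ in atTop, ∀ (x₀ : EuclideanSpace ℝ (Fin d)), ‖x₀‖ ≤ σ →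
      ∀ (γ₀ : covarianceSet d lo hi) (t : ℕ), (t : ℝ) ≤ σ ^ (2 - m) → ∀ Q,
        ENNReal.ofReal (Real.exp (-c * σ ^ m)) ≤ wassersteinMinOne
          (adaptiveMarginal (rwmKernel U hU.contDiff.continuous.measurable q hlo hi) Q t γ₀ x₀)
          (gibbsMeasure U) := by
  obtain ⟨D, hD0, hD⟩ := hU.exists_le_mul_rpow hm
  obtain ⟨d₁, _, _, _, _, _, _, R, hd₁, _, _, _, _, _, _, hR, h⟩ := hU.growth
  -- `C` depends on `s`, so `s` is fixed first and `B ^ m = C + 1` chosen afterwards. Markov's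
  -- exponent is `(4 * D + 1) * (C + 1) - C = 4 * D * (C + 1) + 1`, which suffices because `(B + 1)
  -- ^ m ≤ 4 * B ^ m`.
  set s := (4 * D + 1) / d₁ with hsdef
  have hs : 0 < s := by positivity
  obtain ⟨C, hC, hmom⟩ := hU.exists_moment_bound hm hm₁ q hlo hi hs hD0 hD
  set B := (C + 1) ^ m⁻¹ with hBdef
  have hBm : B ^ m = C + 1 := Real.rpow_inv_rpow (by positivity) hm.ne'
  have hB1 : 1 ≤ B := Real.one_le_rpow (by linarith) (by positivity)
  obtain ⟨c, hc, hW⟩ := exists_exp_le_wassersteinMinOne hd hU hm hD hD0 (zero_le_one.trans hB1)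
  refine ⟨c, hc, ?_⟩
  filter_upwards [hmom, hW, eventually_ge_atTop R, eventually_ge_atTop 1]
    with σ hσm hσW hσR hσ1 x₀ hx₀ γ₀ t ht Q
  refine hσW _ ?_
  have hσ0 : 0 < σ := by linarith
  have hUm := hU.contDiff.continuous.measurable
  set μ := adaptiveMarginal (rwmKernel U hU.contDiff.continuous.measurable q hlo hi) Q t γ₀ x₀
  set E := Real.exp (s * (d₁ * (B * σ) ^ m)) with hE
  have hsub : {x | B * σ < ‖x‖} ⊆ {x | ENNReal.ofReal E ≤ ENNReal.ofReal (Real.exp (s * U x))} := by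
    intro x hx
    have hx' : B * σ < ‖x‖ := hx
    have h1 : σ ≤ B * σ := le_mul_of_one_le_left hσ0.le hB1
    have h2 := (h x (by linarith)).1.1
    refine ENNReal.ofReal_le_ofReal (Real.exp_le_exp.2 ?_)
    refine mul_le_mul_of_nonneg_left (le_trans ?_ h2) hs.le
    gcongr
  have hmk := mul_meas_ge_le_lintegral (μ := μ)
    (f := fun x => ENNReal.ofReal (Real.exp (s * U x))) (by fun_prop) (ENNReal.ofReal E)
  have hmk' : ENNReal.ofReal E * μ {x | B * σ < ‖x‖} ≤ ENNReal.ofReal (Real.exp (C * σ ^ m)) :=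
    le_trans (by gcongr) (hmk.trans (hσm x₀ hx₀ γ₀ t ht Q))
  have hE0 : 0 < E := Real.exp_pos _
  rw [← ENNReal.mul_le_mul_iff_right (a := ENNReal.ofReal E) (by simpa using hE0) (by simp)]
  refine hmk'.trans ?_
  rw [← ENNReal.ofReal_mul hE0.le, hE, ← Real.exp_add]
  refine ENNReal.ofReal_le_ofReal (Real.exp_le_exp.2 ?_)
  have h1 : ((B + 1) * σ) ^ m ≤ 4 * (C + 1) * σ ^ m := by
    calc _ ≤ (2 * (B * σ)) ^ m := by
          rw [← mul_assoc]
          gcongr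
          linarith
      _ = 2 ^ m * (C + 1) * σ ^ m := by
          rw [Real.mul_rpow (by norm_num) (by positivity), Real.mul_rpow (by positivity) hσ0.le,
            hBm, mul_assoc]
      _ ≤ 2 ^ (2 : ℝ) * (C + 1) * σ ^ m := by
          gcongr
          · norm_num
          · linarith
      _ = _ := by norm_num
  have h2 : s * (d₁ * (B * σ) ^ m) = (4 * D + 1) * ((C + 1) * σ ^ m) := by
    rw [Real.mul_rpow (by positivity) hσ0.le, hBm, hsdef]
    field_simp
  have h3 : D * ((B + 1) * σ) ^ m ≤ D * (4 * (C + 1) * σ ^ m) := by gcongr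
  rw [h2]
  linarith

open Filter in
/-- Lower bound on the ballistic scale `t ≤ σ`. -/
theorem PotentialRegularity.exists_lower_bound (hd : 1 ≤ d)
    (hU : PotentialRegularity U m) (hm : 0 < m)
    (q : ProposalDensity d) {lo : ℝ} (hlo : 0 < lo) (hi : ℝ) :
    ∃ c : ℝ, 0 < c ∧ ∀ᶠ σ : ℝ in atTop, ∀ (x₀ : EuclideanSpace ℝ (Fin d)), ‖x₀‖ ≤ σ →
      ∀ (γ₀ : covarianceSet d lo hi) (t : ℕ), (t : ℝ) ≤ σ → ∀ Q,
        ENNReal.ofReal (Real.exp (-c * σ ^ m)) ≤ wassersteinMinOne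
          (adaptiveMarginal (rwmKernel U hU.contDiff.continuous.measurable q hlo hi) Q t γ₀ x₀)
          (gibbsMeasure U) := by
  obtain ⟨D, hD0, hD⟩ := hU.exists_le_mul_rpow hm
  obtain ⟨L, hL, hγ⟩ := exists_norm_increment_le q hlo hi
  obtain ⟨c, hc, hW⟩ := exists_exp_le_wassersteinMinOne hd hU hm hD hD0 (B := 1 + L) (by positivity)
  refine ⟨c, hc, ?_⟩
  filter_upwards [hW] with σ hσW x₀ hx₀ γ₀ t ht Q
  refine hσW _ ?_
  have hUm := hU.contDiff.continuous.measurable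
  have h0 := adaptiveMarginal_norm_gt_eq_zero (rwmKernel U hUm q hlo hi) Q γ₀ x₀ (L := L)
    (fun γ x => ae_rwmMeasure_norm_sub_le U hUm q γ.1 hL.le (hγ γ) x) t
  refine (measure_mono_null ?_ h0).le.trans zero_le
  intro x hx
  have hx' : (1 + L) * σ < ‖x‖ := hx
  show ‖x₀‖ + L * t < ‖x‖
  nlinarith

theorem add_rpow_le_mul_rpow_add_rpow {a b m : ℝ} (ha : 0 ≤ a) (hb : 0 ≤ b) (hm : 0 ≤ m) :
    (a + b) ^ m ≤ 2 ^ m * (a ^ m + b ^ m) := by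
  calc (a + b) ^ m ≤ (2 * max a b) ^ m := by
        gcongr
        linarith [le_max_left a b, le_max_right a b]
    _ = 2 ^ m * max a b ^ m := Real.mul_rpow (by norm_num) (le_max_of_le_left ha)
    _ ≤ _ := by
        gcongr
        rcases max_choice a b with h | h <;> rw [h]
        · linarith [Real.rpow_nonneg hb m]
        · linarith [Real.rpow_nonneg ha m]

-- The diffusive scale serves `m < 1`, with `p = 2 - m`. For `m ≥ 1` the ballistic scale `p = 1` is
-- at least as long.
open Filter in
theorem PotentialRegularity.exists_scale_lower_bound (hd : 1 ≤ d)
    (hU : PotentialRegularity U m) (hm : 0 < m)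
    (q : ProposalDensity d) {lo : ℝ} (hlo : 0 < lo) (hi : ℝ) :
    ∃ p : ℝ, 2 - m ≤ p ∧ ∃ c : ℝ, 0 < c ∧ ∀ᶠ σ : ℝ in atTop,
      ∀ (x₀ : EuclideanSpace ℝ (Fin d)), ‖x₀‖ ≤ σ →
      ∀ (γ₀ : covarianceSet d lo hi) (t : ℕ), (t : ℝ) ≤ σ ^ p → ∀ Q,
        ENNReal.ofReal (Real.exp (-c * σ ^ m)) ≤ wassersteinMinOne
          (adaptiveMarginal (rwmKernel U hU.contDiff.continuous.measurable q hlo hi) Q t γ₀ x₀)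
          (gibbsMeasure U) := by
  rcases lt_or_ge m 1 with h | h
  · exact ⟨2 - m, le_rfl, hU.exists_lower_bound_of_lt_one hd hm h q hlo hi⟩
  · refine ⟨1, by linarith, ?_⟩
    simpa only [Real.rpow_one] using hU.exists_lower_bound hd hm q hlo hi

end LowerBound

/-! ### From the scale `σ` to the time `t`. -/

theorem proposition6p1 {d : ℕ} (hd : 1 ≤ d) {m : ℝ} (hm₀ : 0 < m) (hm₂ : m < 2)
    (U : EuclideanSpace ℝ (Fin d) → ℝ) (hU : PotentialRegularity U m)
    (q : ProposalDensity d) {lo : ℝ} (hlo : 0 < lo) (hi : ℝ) :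
    ∃ c : ℝ, 0 < c ∧ ∀ x₀ : EuclideanSpace ℝ (Fin d), ∃ M : ℝ, 0 < M ∧
      ∀ (γ₀ : covarianceSet d lo hi) (t : ℕ),
        ENNReal.ofReal (M * Real.exp (-c * (t : ℝ) ^ (m / (2 - m)))) ≤
          ⨅ Q : AdaptationPlan (covarianceSet d lo hi) (EuclideanSpace ℝ (Fin d)),
            wassersteinMinOne
              (adaptiveMarginal (rwmKernel U hU.contDiff.continuous.measurable q hlo hi)
                Q t γ₀ x₀)
              (gibbsMeasure U) := by
  obtain ⟨p, hp, c, hc, h⟩ := hU.exists_scale_lower_bound hd hm₀ q hlo hi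
  have hp0 : 0 < p := by linarith
  obtain ⟨σ₀, hσ₀⟩ := Filter.eventually_atTop.1 h
  refine ⟨c * 2 ^ m, by positivity, fun x₀ => ?_⟩
  -- The scale used is `a + t ^ (1 / p)`: large enough for the eventual bound, for the starting
  -- point and for time `t`. Its `a` part goes into `M`, so the rate constant does not depend on
  -- `x₀`.
  set a := max σ₀ ‖x₀‖
  have ha : 0 ≤ a := (norm_nonneg x₀).trans (le_max_right _ _)
  refine ⟨Real.exp (-(c * 2 ^ m * a ^ m)), Real.exp_pos _, fun γ₀ t => le_iInf fun Q => ?_⟩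
  have ht : (0 : ℝ) ≤ t := t.cast_nonneg
  have hb : 0 ≤ (t : ℝ) ^ p⁻¹ := by positivity
  have hts : (t : ℝ) ≤ (a + (t : ℝ) ^ p⁻¹) ^ p := by
    calc (t : ℝ) = ((t : ℝ) ^ p⁻¹) ^ p := (Real.rpow_inv_rpow ht hp0.ne').symm
      _ ≤ _ := by
        gcongr
        linarith
  refine le_trans (ENNReal.ofReal_le_ofReal ?_) (hσ₀ (a + (t : ℝ) ^ p⁻¹)
    (by linarith [le_max_left σ₀ ‖x₀‖]) x₀ (by linarith [le_max_right σ₀ ‖x₀‖]) γ₀ t hts Q)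
  rw [← Real.exp_add]
  refine Real.exp_le_exp.2 ?_
  have h1 := add_rpow_le_mul_rpow_add_rpow ha hb hm₀.le
  have h2 : ((t : ℝ) ^ p⁻¹) ^ m ≤ (t : ℝ) ^ (m / (2 - m)) := by
    rw [← Real.rpow_mul ht]
    -- Comparing exponents needs base at least one; at `t = 0` both powers vanish.
    rcases Nat.eq_zero_or_pos t with rfl | htpos
    · rw [Nat.cast_zero, Real.zero_rpow (by positivity),
        Real.zero_rpow (div_pos hm₀ (by linarith)).ne']
    · refine Real.rpow_le_rpow_of_exponent_le (by exact_mod_cast htpos) ?_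
      rw [inv_mul_eq_div]
      exact div_le_div_of_nonneg_left hm₀.le (by linarith) hp
  have h3 : c * (a + (t : ℝ) ^ p⁻¹) ^ m ≤ c * (2 ^ m * (a ^ m + (t : ℝ) ^ (m / (2 - m)))) := by
    gcongr
    exact h1.trans (by gcongr)
  linarith
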